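/- Let $\mathbb K$ be $\mathbb R$ or $\mathbb C$. A Köthe sequence space is a Banach space $X$ over $\mathbb K$ consisting of sequences in $\mathbb K$ (with the coordinatewise operations) that contains the indicator $\mathbf 1_A$ of every finite $A\subset\mathbb N$ and is solid: if $|f(n)|\le|g(n)|$ for all $n$ and $g\in X$, then $f\in X$ and $\|f\|\le\|g\|$. Its Köthe dual $X'$ is the space of all sequences $g$ such that $\sum_n|f(n)g(n)|<\infty$ for every $f\in X$; each such $g$ is identified with the functional $f\mapsto\sum_n f(n)g(n)$ on $X$, and $X'$ carries the norm of $X^*$. Put $X''=(X')'$. The space $X$ is rearrangement invariant (r.i.) if 1. for every bijection $\tau:\mathbb N\to\mathbb N$ and every sequence $f$ one has $f\in X$ if and only if $f\circ\tau^{-1}\in X$, and then $\|f\|=\|f\circ\tau^{-1}\|$; 2. $X'$ is norming for $X$, i.e. $\|x\|=\sup\{|g(x)|: g\in X',\ \|g\|\le1\}$ for all $x\in X$, and, as a subspace of $X''$, either $X=X''$ or $X$ is the closed linear span in $X''$ of the finitely supported sequences; 3. $\ell_1\subset X\subset\ell_\infty$, with $\|f\|_X\le\|f\|_1$ for $f\in\ell_1$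 and $\|f\|_\infty\le\|f\|_X$ for $f\in X$. A Banach space $X$ has numerical index $1$ if every bounded linear operator $T:X\to X$ satisfies $$\sup\{|x^*(Tx)|:\ x\in X,\ x^*\in X^*,\ \|x\|=\|x^*\|=x^*(x)=1\}=\|T\|,$$ and it has the alternative Daugavet property if $\max_{|\theta|=1}\|\mathrm{Id}+\theta T\|=1+\|T\|$ for every operator $T=x^*\otimes e$ with $x^*\in X^*$, $e\in X$ (where $\theta$ ranges over the scalars of modulus one). Theorem. The spaces $c_0$ and $\ell_1$ (with their usual norms) are separable r.i. sequence spaces that have numerical index $1$ and the alternative Daugavet property. Conversely, they are the only ones: for a separable r.i. sequence space $X$, each of the two properties - $X$ has numerical index $1$, - $X$ has the alternative Daugavet property, holds if and only if $X=c_0$ or $X=\ell_1$, with equality of the norms. -/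

import Mathlib

open scoped ENNReal ZeroAtInfty

noncomputable section

/-! A Banach space of scalar sequences is presented as a Banach space `X` over `𝕜` together with
a linear map `J : X →ₗ[𝕜] (ℕ → 𝕜)`, sending an element to the sequence that it is; the map is
injective for all the spaces below (`IsKotheSeqSpace.injective`). The measure on `ℕ` is the counting
measure, for which every sequence is measurable and locally integrable. -/

section SequenceSpaces

variable {𝕜 : Type*} [RCLike 𝕜]
variable {X : Type*} [NormedAddCommGroup X] [NormedSpace 𝕜 X]
variable {Y : Type*} [NormedAddCommGroup Y] [NormedSpace 𝕜 Y]

/-- Two Banach spaces of sequences are the same one: they consist of the same sequences,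
with the same norm. -/
def SameSeqSpace (J : X →ₗ[𝕜] (ℕ → 𝕜)) (K : Y →ₗ[𝕜] (ℕ → 𝕜)) : Prop :=
  ∃ e : X ≃ₗᵢ[𝕜] Y, ∀ x : X, K (e x) = J x

/-- Köthe function spaces over `ℕ` (completeness of `X` is assumed separately). -/
structure IsKotheSeqSpace (J : X →ₗ[𝕜] (ℕ → 𝕜)) : Prop where
  injective : Function.Injective J
  solid : ∀ (f : ℕ → 𝕜) (g : X), (∀ n, ‖f n‖ ≤ ‖J g n‖) → ∃ x : X, J x = f ∧ ‖x‖ ≤ ‖g‖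
  indicator_mem : ∀ A : Set ℕ, A.Finite → ∃ x : X, J x = A.indicator (fun _ => (1 : 𝕜))

/-- The element `e_n = 1_{n}` of a Köthe sequence space. -/
def unitVec (J : X →ₗ[𝕜] (ℕ → 𝕜)) (n : ℕ) : X :=
  Function.invFun J (Pi.single n 1)

/-- The Köthe dual `X'`: the space of all integrals, that is, of all functionals
`x ↦ ∑ n, x n * g n` with `g` such that these series converge (absolutely) for all `x` in `X`.
It carries the norm of the dual space. -/
def kotheDual (J : X →ₗ[𝕜] (ℕ → 𝕜)) : Submodule 𝕜 (StrongDual 𝕜 X) where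
  carrier := {φ | ∃ g : ℕ → 𝕜, ∀ x : X, HasSum (fun n => J x n * g n) (φ x)}
  zero_mem' := ⟨0, fun x => by simp⟩
  add_mem' := by
    rintro φ ψ ⟨g, hg⟩ ⟨h, hh⟩
    exact ⟨g + h, fun x => by simpa [mul_add] using (hg x).add (hh x)⟩
  smul_mem' := by
    rintro c φ ⟨g, hg⟩
    exact ⟨c • g, fun x => by simpa [mul_left_comm] using (hg x).mul_left c⟩

/-- The Köthe dual as a normed space in its own right, with the norm of the dual space. -/
def KotheDual (J : X →ₗ[𝕜] (ℕ → 𝕜)) : Type _ := kotheDual J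

instance (J : X →ₗ[𝕜] (ℕ → 𝕜)) : NormedAddCommGroup (KotheDual J) :=
  inferInstanceAs (NormedAddCommGroup (kotheDual J))

instance (J : X →ₗ[𝕜] (ℕ → 𝕜)) : NormedSpace 𝕜 (KotheDual J) :=
  inferInstanceAs (NormedSpace 𝕜 (kotheDual J))

/-- The inclusion of the Köthe dual into the dual space. -/
def KotheDual.toDual (J : X →ₗ[𝕜] (ℕ → 𝕜)) : KotheDual J →ₗᵢ[𝕜] StrongDual 𝕜 X :=
  (kotheDual J).subtypeₗᵢ

/-- The Köthe dual as a space of sequences: the integral `x ↦ ∑ n, x n * g n` is identified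
with `g`, whose `n`-th term is the value of the integral at `e_n`. -/
def kotheDualSeq (J : X →ₗ[𝕜] (ℕ → 𝕜)) : KotheDual J →ₗ[𝕜] (ℕ → 𝕜) where
  toFun φ n := KotheDual.toDual J φ (unitVec J n)
  map_add' _ _ := by ext n; simp
  map_smul' _ _ := by ext n; simp

/-- The second Köthe dual `X''`, the Köthe dual of the sequence space `X'`. -/
abbrev KotheBidual (J : X →ₗ[𝕜] (ℕ → 𝕜)) : Type _ := KotheDual (kotheDualSeq J)

/-- The second Köthe dual as a space of sequences. -/
abbrev kotheBidualSeq (J : X →ₗ[𝕜] (ℕ → 𝕜)) : KotheBidual J →ₗ[𝕜] (ℕ → 𝕜) :=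
  kotheDualSeq (kotheDualSeq J)

/-- The sequence space `X` as a subspace of `X''`: the elements of `X''` which, as sequences,
belong to `X`. -/
def inKotheBidual (J : X →ₗ[𝕜] (ℕ → 𝕜)) : Submodule 𝕜 (KotheBidual J) :=
  (LinearMap.range J).comap (kotheBidualSeq J)

/-- The closed linear span in `X''` of the simple integrable functions, which over `ℕ` are the
finitely supported sequences. -/
def simpleClosure (J : X →ₗ[𝕜] (ℕ → 𝕜)) : Submodule 𝕜 (KotheBidual J) :=
  (Submodule.span 𝕜
    {ψ : KotheBidual J | (Function.support (kotheBidualSeq J ψ)).Finite}).topologicalClosure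

/-- Rearrangement invariant sequence spaces. -/
structure IsRISeqSpace (J : X →ₗ[𝕜] (ℕ → 𝕜)) : Prop extends IsKotheSeqSpace J where
  /-- Membership is invariant under permutations of `ℕ`. -/
  perm_mem_iff : ∀ (τ : Equiv.Perm ℕ) (f : ℕ → 𝕜),
    f ∈ LinearMap.range J ↔ f ∘ τ.symm ∈ LinearMap.range J
  /-- The norm is invariant under permutations of `ℕ`. -/
  norm_perm : ∀ (τ : Equiv.Perm ℕ) (x y : X), J y = J x ∘ τ.symm → ‖y‖ = ‖x‖
  /-- `X'` is norming for `X`. -/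
  norming : ∀ x : X,
    IsLUB {r : ℝ | ∃ φ ∈ kotheDual J, ‖φ‖ ≤ 1 ∧ r = ‖φ x‖} ‖x‖
  /-- `X = X''`, or `X` is the closed linear span of the simple integrable functions of `X''`. -/
  maximal_or_minimal : inKotheBidual J = ⊤ ∨ inKotheBidual J = simpleClosure J
  /-- `ℓ¹ ⊆ X` with inclusion of norm at most one. -/
  l1_subset : ∀ f : lp (fun _ : ℕ => 𝕜) 1, ∃ x : X, J x = (f : ℕ → 𝕜) ∧ ‖x‖ ≤ ‖f‖
  /-- `X ⊆ ℓ^∞` with inclusion of norm at most one. -/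
  subset_linfty : ∀ (x : X) (n : ℕ), ‖J x n‖ ≤ ‖x‖

end SequenceSpaces

section ConcreteSpaces

variable (𝕜 : Type*) [RCLike 𝕜]

/-- The Banach space `c₀` of null sequences with the supremum norm, as a sequence space. -/
def c0Seq : C₀(ℕ, 𝕜) →ₗ[𝕜] (ℕ → 𝕜) where
  toFun f := f
  map_add' _ _ := rfl
  map_smul' _ _ := rfl

/-- The Banach space `ℓ¹` of absolutely summable sequences, as a sequence space. -/
def l1Seq : lp (fun _ : ℕ => 𝕜) 1 →ₗ[𝕜] (ℕ → 𝕜) where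
  toFun f := f
  map_add' _ _ := rfl
  map_smul' _ _ := rfl

end ConcreteSpaces

section NumericalIndex

/-- The numerical radius of a bounded operator. -/
def numericalRadius {𝕜 X : Type*} [RCLike 𝕜] [NormedAddCommGroup X] [NormedSpace 𝕜 X]
    (T : X →L[𝕜] X) : ℝ :=
  sSup {r : ℝ | ∃ (x : X) (φ : StrongDual 𝕜 X), ‖x‖ = 1 ∧ ‖φ‖ = 1 ∧ φ x = 1 ∧ r = ‖φ (T x)‖}

/-- Numerical index `1`. -/
def HasNumericalIndexOne (𝕜 X : Type*) [RCLike 𝕜] [NormedAddCommGroup X] [NormedSpace 𝕜 X] :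
    Prop :=
  ∀ T : X →L[𝕜] X, numericalRadius T = ‖T‖

/-- The alternative Daugavet property: for every operator `T = φ ⊗ e` the maximum of
`‖Id + θ T‖` over the scalars `θ` of modulus one is `1 + ‖T‖`. -/
def HasAlternativeDaugavet (𝕜 X : Type*) [RCLike 𝕜] [NormedAddCommGroup X] [NormedSpace 𝕜 X] :
    Prop :=
  ∀ (φ : StrongDual 𝕜 X) (e : X),
    IsGreatest
      {r : ℝ | ∃ θ : 𝕜, ‖θ‖ = 1 ∧ r = ‖ContinuousLinearMap.id 𝕜 X + θ • φ.smulRight e‖}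
      (1 + ‖φ.smulRight e‖)

end NumericalIndex

end

noncomputable section

/-! Numerical index 1 always gives the alternative Daugavet property on a nonzero space, so the
converse needs only the latter. For norm-one φ and e it yields y and ψ in the unit balls with
|φ(y)|, |ψ(e)| and |ψ(y)| all close to 1 (`exists_norm_ge`). Rearrangement invariance adds an
exchange inequality (`norm_apply_add_le`): when ψ nearly norms y, the moduli |y_i| and |ψ(e_i)|
cannot be ordered in clearly opposite ways.

The number a = ‖e_0 + e_1‖ decides the space. If a ≤ 1, taking φ as the mean of the first n
coordinates and e = e_n makes y almost unimodular on n + 1 coordinates, so by induction all sums e_0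
+ ... + e_n have norm at most 1; the norm is then the supremum norm, and separability forces null
sequences. If a > 1, the dual choice, φ the n-th coordinate and e the mean of the first n unit
vectors, makes |ψ(e_i)| almost 1 for n + 1 indices, and by induction the ℓ¹ norm is at most the norm
of X.

That c₀ and ℓ¹ have numerical index 1 is shown directly, by nearly norming an operator at a
coordinate functional or at a unit vector, respectively. -/

theorem exists_phase {𝕜 : Type*} [RCLike 𝕜] (z : 𝕜) :
    ∃ c : 𝕜, ‖c‖ = 1 ∧ ((‖z‖ : ℝ) : 𝕜) = c * z :=
  RCLike.exists_norm_eq_mul_self z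

/-! ### Unit vectors, solidity and the exchange inequality. -/

section KotheSpaces

variable {𝕜 : Type*} [RCLike 𝕜] {X : Type*} [NormedAddCommGroup X] [NormedSpace 𝕜 X]
  {J : X →ₗ[𝕜] (ℕ → 𝕜)}

theorem apply_unitVec_of_exists {n : ℕ} (h : ∃ x : X, J x = Pi.single n 1) :
    J (unitVec J n) = Pi.single n 1 :=
  Function.invFun_eq h

namespace IsKotheSeqSpace

theorem apply_unitVec (h : IsKotheSeqSpace J) (n : ℕ) : J (unitVec J n) = Pi.single n 1 := by
  apply apply_unitVec_of_exists
  obtain ⟨x, hx⟩ := h.indicator_mem {n} (Set.finite_singleton n)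
  refine ⟨x, hx.trans ?_⟩
  ext m
  by_cases hm : m = n<;> simp [hm]

theorem apply_sum_smul_unitVec (h : IsKotheSeqSpace J) (s : Finset ℕ) (f : ℕ → 𝕜) (n : ℕ) :
    J (∑ i ∈ s, f i • unitVec J i) n = if n ∈ s then f n else 0 := by
  simp [h.apply_unitVec, Pi.single_apply]

theorem norm_le_of_le (h : IsKotheSeqSpace J) {x y : X} (hxy : ∀ n, ‖J x n‖ ≤ ‖J y n‖) :
    ‖x‖ ≤ ‖y‖ := by
  obtain ⟨z, hz, hzy⟩ := h.solid (J x) y hxy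
  rwa [← h.injective hz]

end IsKotheSeqSpace

namespace IsRISeqSpace

/-- The coordinate functionals. -/
def coord (h : IsRISeqSpace J) (n : ℕ) : StrongDual 𝕜 X :=
  LinearMap.mkContinuous ((LinearMap.proj n).comp J) 1 fun x => by
    simpa using h.subset_linfty x n

@[simp] theorem coord_apply (h : IsRISeqSpace J) (n : ℕ) (x : X) : h.coord n x = J x n := rfl

theorem norm_unitVec (h : IsRISeqSpace J) (n : ℕ) : ‖unitVec J n‖ = 1 := by
  apply le_antisymm
  · obtain ⟨x, hx, hx'⟩ := h.l1_subset (lp.single 1 n (1 : 𝕜))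
    have : x = unitVec J n := h.injective (by
      rw [hx, h.apply_unitVec, lp.coeFn_single])
    rw [← this]
    refine hx'.trans ?_
    rw [lp.norm_single (by norm_num)]
    simp
  · simpa [h.apply_unitVec] using h.subset_linfty (unitVec J n) n

theorem exists_perm (h : IsRISeqSpace J) (τ : Equiv.Perm ℕ) (y : X) :
    ∃ w : X, J w = J y ∘ τ.symm ∧ ‖w‖ = ‖y‖ := by
  obtain ⟨w, hw⟩ := (h.perm_mem_iff τ (J y)).1 ⟨y, rfl⟩
  exact ⟨w, hw, h.norm_perm τ y w hw⟩

/-- Exchanging 1 and n fixes 0, so the single number ‖e_0 + e_1‖ governs every pair e_0, e_n. -/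
theorem norm_unitVec_zero_add (h : IsRISeqSpace J) {n : ℕ} (hn : n ≠ 0) :
    ‖unitVec J 0 + unitVec J n‖ = ‖unitVec J 0 + unitVec J 1‖ := by
  apply h.norm_perm (Equiv.swap 1 n)
  ext m
  simp only [map_add, h.apply_unitVec, Pi.add_apply, Function.comp, Equiv.symm_swap,
    Pi.single_apply]
  by_cases h1 : m = 1
  · subst h1
    rcases eq_or_ne n 1 with rfl | h2
    · simp
    · simp [hn, h2, h2.symm]
  · by_cases h2 : m = n
    · subst h2; simp [hn]
    · rw [Equiv.swap_apply_of_ne_of_ne h1 h2]; simp [h1, h2]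

/-- Exchanging the moduli of two coordinates of a vector does not increase the norm, whatever the
phases are. -/
theorem norm_swap_le (h : IsRISeqSpace J) {i j : ℕ} (hij : i ≠ j) (y : X) {α β γ : 𝕜}
    (hα : ‖α‖ ≤ ‖J y j‖) (hβ : ‖β‖ ≤ ‖J y i‖) (hγ : ‖γ‖ ≤ 1) :
    ‖α • unitVec J i + β • unitVec J j +
      γ • (y - J y i • unitVec J i - J y j • unitVec J j)‖ ≤ ‖y‖ := by
  -- w is y with the coordinates i and j exchanged; it dominates the vector in question
  -- coordinatewise.
  obtain ⟨w, hw, hwy⟩ := h.exists_perm (Equiv.swap i j) y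
  rw [← hwy]
  apply h.norm_le_of_le
  intro n
  simp only [hw, map_add, map_sub, map_smul, h.apply_unitVec, Pi.add_apply, Pi.sub_apply,
    Pi.smul_apply, Function.comp, Equiv.symm_swap, Pi.single_apply, smul_eq_mul]
  by_cases h1 : n = i
  · subst h1; simpa [hij] using hα
  · by_cases h2 : n = j
    · subst h2; simpa [hij.symm] using hβ
    · rw [Equiv.swap_apply_of_ne_of_ne h1 h2]
      simpa [h1, h2] using mul_le_mul_of_nonneg_right hγ (norm_nonneg (J y n))

/-- Exchanging |y_i| and |y_j|, with phases aligned to ψ, gives a vector of the unit ball on which ψ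
is |y_j||ψ(e_i)| + |y_i||ψ(e_j)| + |ψ(r)|, r being the rest of y. The product is the excess of this
over the triangle bound for |ψ(y)|. -/
theorem norm_apply_add_le (h : IsRISeqSpace J) {i j : ℕ} (hij : i ≠ j) {y : X}
    {ψ : StrongDual 𝕜 X} (hy : ‖y‖ ≤ 1) (hψ : ‖ψ‖ ≤ 1) :
    ‖ψ y‖ + (‖ψ (unitVec J i)‖ - ‖ψ (unitVec J j)‖) * (‖J y j‖ - ‖J y i‖) ≤ 1 := by
  set r := y - J y i • unitVec J i - J y j • unitVec J j with hr
  obtain ⟨a, ha, ha'⟩ := exists_phase (ψ (unitVec J i))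
  obtain ⟨b, hb, hb'⟩ := exists_phase (ψ (unitVec J j))
  obtain ⟨c, hc, hc'⟩ := exists_phase (ψ r)
  have key := h.norm_swap_le hij y (α := (‖J y j‖ : 𝕜) * a) (β := (‖J y i‖ : 𝕜) * b) (γ := c)
    (by simp [ha]) (by simp [hb]) hc.le
  rw [← hr] at key
  have h1 := ψ.le_of_opNorm_le_of_le hψ (key.trans hy)
  have h2 : ψ (((‖J y j‖ : 𝕜) * a) • unitVec J i + ((‖J y i‖ : 𝕜) * b) • unitVec J j + c • r)
      = ((‖J y j‖ * ‖ψ (unitVec J i)‖ + ‖J y i‖ * ‖ψ (unitVec J j)‖ + ‖ψ r‖ : ℝ) : 𝕜) := by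
    simp only [RCLike.ofReal_add, RCLike.ofReal_mul]
    rw [ha', hb', hc']
    simp only [map_add, map_smul, smul_eq_mul]
    ring
  rw [h2, RCLike.norm_of_nonneg (by positivity)] at h1
  have h3 : ψ y = J y i * ψ (unitVec J i) + J y j * ψ (unitVec J j) + ψ r := by
    simp [hr]
  have h4 : ‖ψ y‖ ≤ ‖J y i‖ * ‖ψ (unitVec J i)‖ + ‖J y j‖ * ‖ψ (unitVec J j)‖ + ‖ψ r‖ := by
    rw [h3, ← norm_mul, ← norm_mul]
    exact norm_add₃_le
  nlinarith

/-- A functional is at least as large on the modulus of `x`, up to phases. -/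
theorem sum_norm_mul_norm_le (h : IsRISeqSpace J) (s : Finset ℕ) (x : X)
    {ψ : StrongDual 𝕜 X} (hψ : ‖ψ‖ ≤ 1) :
    ∑ i ∈ s, ‖J x i‖ * ‖ψ (unitVec J i)‖ ≤ ‖x‖ := by
  choose a ha ha' using fun i => exists_phase (ψ (unitVec J i))
  -- Solidity allows replacing the phases of x by those that make every term of ψ nonnegative.
  have hle : ‖∑ i ∈ s, ((‖J x i‖ : 𝕜) * a i) • unitVec J i‖ ≤ ‖x‖ := by
    apply h.norm_le_of_le
    intro n
    rw [h.apply_sum_smul_unitVec]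
    split_ifs <;> simp [ha]
  have h1 := ψ.le_of_opNorm_le_of_le hψ hle
  have h2 : ψ (∑ i ∈ s, ((‖J x i‖ : 𝕜) * a i) • unitVec J i) =
      ((∑ i ∈ s, ‖J x i‖ * ‖ψ (unitVec J i)‖ : ℝ) : 𝕜) := by
    rw [map_sum, RCLike.ofReal_sum]
    refine Finset.sum_congr rfl fun i _ => ?_
    rw [RCLike.ofReal_mul, ha', map_smul, smul_eq_mul, mul_assoc]
  rw [h2, RCLike.norm_of_nonneg (Finset.sum_nonneg fun i _ => by positivity)] at h1
  simpa using h1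

end IsRISeqSpace

end KotheSpaces

/-! ### Elementary estimates. -/

theorem le_of_forall_le_add_mul {a b C δ : ℝ} (hδ : 0 < δ)
    (h : ∀ ε, 0 < ε → ε ≤ δ → a ≤ b + C * ε) : a ≤ b := by
  have hlim : Filter.Tendsto (fun ε : ℝ => b + C * ε) (nhdsWithin 0 (Set.Ioi 0)) (nhds b) := by
    have : Filter.Tendsto (fun ε : ℝ => b + C * ε) (nhds 0) (nhds (b + C * 0)) :=
      Continuous.tendsto (by fun_prop) 0
    simpa using this.mono_left nhdsWithin_le_nhds
  refine ge_of_tendsto hlim ?_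
  filter_upwards [Ioc_mem_nhdsGT hδ] with ε hε
  exact h ε hε.1 hε.2

/-- The other n - 1 terms contribute at most n - 1 to the norm of the sum. -/
theorem norm_ge_of_norm_sum_ge {E : Type*} [SeminormedAddCommGroup E] {n : ℕ} {z : ℕ → E} {ε : ℝ}
    (hz : ∀ i ∈ Finset.range n, ‖z i‖ ≤ 1) (hs : n * (1 - ε) ≤ ‖∑ i ∈ Finset.range n, z i‖)
    {i : ℕ} (hi : i < n) : 1 - n * ε ≤ ‖z i‖ := by
  have hi' := Finset.mem_range.2 hi
  have h1 := hs.trans (norm_sum_le _ _)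
  rw [← Finset.add_sum_erase _ _ hi'] at h1
  have h2 : ∑ j ∈ (Finset.range n).erase i, ‖z j‖ ≤ ∑ j ∈ (Finset.range n).erase i, (1 : ℝ) :=
    Finset.sum_le_sum fun j hj => hz j (Finset.mem_of_mem_erase hj)
  rw [Finset.sum_const, Finset.card_erase_of_mem hi', Finset.card_range, nsmul_eq_mul,
    Nat.cast_sub (by omega)] at h2
  push_cast at h2
  linarith

/-! ### Consequences of the alternative Daugavet property: the two inductions. -/

section AlternativeDaugavet

variable {𝕜 : Type*} [RCLike 𝕜] {X : Type*} [NormedAddCommGroup X] [NormedSpace 𝕜 X]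
  {J : X →ₗ[𝕜] (ℕ → 𝕜)}

/-- A vector y almost attaining ‖Id + θT‖ = 2, and ψ norming its image, give |ψ(y)| + |φ(y)||ψ(e)| >
2 - ε. Since no factor exceeds 1, each is at least 1 - ε; θ matters only through its modulus. -/
theorem HasAlternativeDaugavet.exists_norm_ge (hX : HasAlternativeDaugavet 𝕜 X)
    {φ : StrongDual 𝕜 X} {e : X} (hφ : ‖φ‖ = 1) (he : ‖e‖ = 1) {ε : ℝ} (hε : 0 < ε) (hε1 : ε < 1) :
    ∃ (y : X) (ψ : StrongDual 𝕜 X), ‖y‖ ≤ 1 ∧ ‖ψ‖ ≤ 1 ∧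
      1 - ε ≤ ‖φ y‖ ∧ 1 - ε ≤ ‖ψ e‖ ∧ 1 - ε ≤ ‖ψ y‖ := by
  obtain ⟨θ, hθ, h⟩ := (hX φ e).1
  rw [ContinuousLinearMap.norm_smulRight_apply, hφ, he] at h
  obtain ⟨y, hy, hlt⟩ := ContinuousLinearMap.exists_lt_apply_of_lt_opNorm
    (ContinuousLinearMap.id 𝕜 X + θ • φ.smulRight e) (r := 2 - ε) (by rw [← h]; linarith)
  obtain ⟨ψ, hψ, hψ'⟩ := exists_dual_vector'' 𝕜
    ((ContinuousLinearMap.id 𝕜 X + θ • φ.smulRight e) y)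
  have h1 : ‖(ContinuousLinearMap.id 𝕜 X + θ • φ.smulRight e) y‖ ≤ ‖ψ y‖ + ‖φ y‖ * ‖ψ e‖ := by
    have := congrArg norm hψ'
    rw [RCLike.norm_ofReal, abs_norm] at this
    rw [← this]
    simp only [add_apply, ContinuousLinearMap.id_apply,
      smul_apply, ContinuousLinearMap.smulRight_apply, map_add, map_smul,
      smul_eq_mul]
    refine (norm_add_le _ _).trans ?_
    simp [hθ]
  have h2 : ‖ψ y‖ ≤ 1 := by simpa using ψ.le_of_opNorm_le_of_le hψ hy.le
  have h3 : ‖φ y‖ ≤ 1 := by simpa using φ.le_of_opNorm_le_of_le hφ.le hy.le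
  have h4 : ‖ψ e‖ ≤ 1 := by simpa using ψ.le_of_opNorm_le_of_le hψ he.le
  refine ⟨y, ψ, hy.le, hψ, ?_, ?_, ?_⟩ <;> nlinarith [norm_nonneg (φ y), norm_nonneg (ψ e)]

namespace IsRISeqSpace

theorem norm_sum_unitVec_succ_le (h : IsRISeqSpace J) (hX : HasAlternativeDaugavet 𝕜 X)
    (h2 : ‖unitVec J 0 + unitVec J 1‖ ≤ 1) {n : ℕ} (hn0 : 0 < n)
    (hn : ‖∑ i ∈ Finset.range n, unitVec J i‖ ≤ 1) :
    ‖∑ i ∈ Finset.range (n + 1), unitVec J i‖ ≤ 1 := by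
  have hn0' : (n : 𝕜) ≠ 0 := by exact_mod_cast hn0.ne'
  have hn0r : (0 : ℝ) < n := by exact_mod_cast hn0
  set φ : StrongDual 𝕜 X := (n : 𝕜)⁻¹ • ∑ i ∈ Finset.range n, h.coord i with hφdef
  have hφa : ∀ y, φ y = (n : 𝕜)⁻¹ * ∑ i ∈ Finset.range n, J y i := by
    intro y; simp [hφdef]
  have hφ1 : ‖φ‖ ≤ 1 := by
    refine ContinuousLinearMap.opNorm_le_bound _ zero_le_one fun x => ?_
    rw [hφa, norm_mul, norm_inv, RCLike.norm_natCast, one_mul, inv_mul_le_iff₀ hn0r]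
    refine (norm_sum_le _ _).trans ((Finset.sum_le_card_nsmul _ _ ‖x‖
      fun i _ => h.subset_linfty x i).trans ?_)
    simp
  -- The inductive hypothesis enters here: the sum of the first n unit vectors lies in the unit ball
  -- and φ equals 1 on it.
  have hφ : ‖φ‖ = 1 := by
    refine le_antisymm hφ1 ?_
    have h1 := φ.le_opNorm_of_le hn
    have h3 : φ (∑ i ∈ Finset.range n, unitVec J i) = 1 := by
      have : ∀ i ∈ Finset.range n, J (∑ i ∈ Finset.range n, unitVec J i) i = 1 := by
        intro i hi
        simpa [Finset.mem_range.1 hi] using h.apply_sum_smul_unitVec (Finset.range n) 1 i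
      rw [hφa, Finset.sum_congr rfl this]
      simp [hn0']
    simpa [h3] using h1
  -- The aim is (1 - (n + 2)ε)‖∑ e_i‖ ≤ 1; ε ≤ 1/4 keeps 1 - 2ε at least 1/2.
  refine le_of_forall_le_add_mul (C := (n + 2) * ‖∑ i ∈ Finset.range (n + 1), unitVec J i‖)
    (δ := 1 / 4) (by norm_num) fun ε hε hε4 => ?_
  obtain ⟨y, ψ, hy, hψ, hφy, hψe, hψy⟩ :=
    hX.exists_norm_ge hφ (h.norm_unitVec n) hε (by linarith)
  have hyi : ∀ i < n, 1 - n * ε ≤ ‖J y i‖ := by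
    intro i hi
    refine norm_ge_of_norm_sum_ge (z := fun i => J y i)
      (fun i _ => (h.subset_linfty y i).trans hy) ?_ hi
    rw [hφa, norm_mul, norm_inv, RCLike.norm_natCast] at hφy
    rwa [le_inv_mul_iff₀ hn0r] at hφy
  -- As |ψ(e_n)| ≥ 1 - ε, this forces |ψ(e_0)| ≤ ε. The exchange inequality then bounds (1 -
  -- 2ε)(|y_0| - |y_n|) by ε, so |y_n| is at most 2ε below |y_0|.
  have hq : ‖ψ (unitVec J 0)‖ + ‖ψ (unitVec J n)‖ ≤ 1 := by
    have h1 := h.sum_norm_mul_norm_le {0, n} (unitVec J 0 + unitVec J n) hψ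
    rw [h.norm_unitVec_zero_add hn0.ne', Finset.sum_pair hn0.ne] at h1
    simpa [h.apply_unitVec, Pi.single_apply, hn0.ne, hn0.ne'] using h1.trans h2
  have hs := h.norm_apply_add_le hn0.ne' hy hψ
  have hy0 := hyi 0 hn0
  have hyn : 1 - (n + 2) * ε ≤ ‖J y n‖ := by
    by_contra! hc
    have : 2 * ε < ‖J y 0‖ - ‖J y n‖ := by linarith
    nlinarith
  have hC : ‖((1 - (n + 2) * ε : ℝ) : 𝕜) • ∑ i ∈ Finset.range (n + 1), unitVec J i‖ ≤ 1 ∨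
      1 - (n + 2) * ε < 0 := by
    rcases lt_or_ge (1 - (n + 2) * ε) 0 with hneg | hpos
    · exact Or.inr hneg
    refine Or.inl ((h.norm_le_of_le fun i => ?_).trans hy)
    rw [Finset.smul_sum, h.apply_sum_smul_unitVec]
    split_ifs with hi
    · rw [RCLike.norm_of_nonneg hpos]
      rcases Nat.lt_succ_iff_lt_or_eq.1 (Finset.mem_range.1 hi) with hi | rfl
      · have := hyi i hi
        linarith
      · exact hyn
    · simp
  rcases hC with hC | hC
  · rw [norm_smul, RCLike.norm_ofReal] at hC
    have := mul_le_mul_of_nonneg_right (le_abs_self (1 - (n + 2) * ε))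
      (norm_nonneg (∑ i ∈ Finset.range (n + 1), unitVec J i))
    linarith
  -- Here (n + 2)ε > 1, and the error term alone exceeds the norm.
  · nlinarith [norm_nonneg (∑ i ∈ Finset.range (n + 1), unitVec J i)]

theorem sum_range_succ_norm_le (h : IsRISeqSpace J) (hX : HasAlternativeDaugavet 𝕜 X)
    (h2 : 1 < ‖unitVec J 0 + unitVec J 1‖) {n : ℕ} (hn0 : 0 < n)
    (hn : ∀ x : X, ∑ i ∈ Finset.range n, ‖J x i‖ ≤ ‖x‖) (x : X) :
    ∑ i ∈ Finset.range (n + 1), ‖J x i‖ ≤ ‖x‖ := by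
  have hn0' : (n : 𝕜) ≠ 0 := by exact_mod_cast hn0.ne'
  have hn0r : (0 : ℝ) < n := by exact_mod_cast hn0
  have hφ : ‖h.coord n‖ = 1 := by
    refine le_antisymm (LinearMap.mkContinuous_norm_le _ zero_le_one _) ?_
    simpa [h.apply_unitVec, h.norm_unitVec] using (h.coord n).le_opNorm (unitVec J n)
  -- The lower bound is the inductive hypothesis applied to the sum itself.
  have hsum : ‖∑ i ∈ Finset.range n, unitVec J i‖ = n := by
    apply le_antisymm
    · refine (norm_sum_le _ _).trans ?_
      simp [h.norm_unitVec]
    · refine le_trans (le_of_eq ?_) (hn _)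
      have : ∀ i ∈ Finset.range n, ‖J (∑ i ∈ Finset.range n, unitVec J i) i‖ = 1 := by
        intro i hi
        have := h.apply_sum_smul_unitVec (Finset.range n) 1 i
        simp only [Pi.one_apply, one_smul] at this
        rw [this]
        simp [Finset.mem_range.1 hi]
      rw [Finset.sum_congr rfl this]
      simp
  have he : ‖(n : 𝕜)⁻¹ • ∑ i ∈ Finset.range n, unitVec J i‖ = 1 := by
    rw [norm_smul, hsum, norm_inv, RCLike.norm_natCast, inv_mul_cancel₀ hn0r.ne']
  set a := ‖unitVec J 0 + unitVec J 1‖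
  set d := 1 - 1 / a with hd
  have hd0 : 0 < d := by
    rw [hd, sub_pos, div_lt_one (by linarith)]
    exact h2
  have hd1 : d < 1 := by
    have : 0 < 1 / a := by positivity
    linarith
  -- With ε ≤ d/3, |y_n| ≥ 1 - ε exceeds 1/a = 1 - d by at least d/2. The exchange inequality
  -- divides the defect ε by this gap, whence 2/d.
  refine le_of_forall_le_add_mul (C := (n + 2 / d) * ∑ i ∈ Finset.range (n + 1), ‖J x i‖)
    (δ := d / 3) (by positivity) fun ε hε hεd => ?_
  obtain ⟨y, ψ, hy, hψ, hφy, hψe, hψy⟩ := hX.exists_norm_ge hφ he hε (by linarith)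
  have hψi : ∀ i < n, 1 - n * ε ≤ ‖ψ (unitVec J i)‖ := by
    intro i hi
    refine norm_ge_of_norm_sum_ge (z := fun i => ψ (unitVec J i))
      (fun i _ => by simpa using ψ.le_of_opNorm_le_of_le hψ (h.norm_unitVec i).le) ?_ hi
    rw [map_smul, map_sum, norm_smul, norm_inv, RCLike.norm_natCast] at hψe
    rwa [le_inv_mul_iff₀ hn0r] at hψe
  rw [h.coord_apply] at hφy
  -- Otherwise y dominates a multiple of e_0 + e_n with factor above 1/a, whose norm exceeds 1.
  have hy0 : ‖J y 0‖ ≤ 1 / a := by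
    by_contra! hc
    have hn' : 1 / a < ‖J y n‖ := by linarith
    have hmin : 1 / a < min ‖J y 0‖ ‖J y n‖ := lt_min hc hn'
    have h1 : ‖((min ‖J y 0‖ ‖J y n‖ : ℝ) : 𝕜) • (unitVec J 0 + unitVec J n)‖ ≤ 1 := by
      refine (h.norm_le_of_le fun i => ?_).trans hy
      have hm : 0 ≤ min ‖J y 0‖ ‖J y n‖ := by positivity
      simp only [map_smul, map_add, h.apply_unitVec, Pi.smul_apply, Pi.add_apply, norm_smul,
        RCLike.norm_of_nonneg hm, Pi.single_apply]
      by_cases hi0 : i = 0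
      · subst hi0; simp [hn0.ne]
      · by_cases hin : i = n
        · subst hin; simp [hi0]
        · simp [hi0, hin]
    rw [norm_smul, h.norm_unitVec_zero_add hn0.ne', RCLike.norm_of_nonneg (by positivity)] at h1
    rw [div_lt_iff₀ (by linarith)] at hmin
    linarith
  have hs := h.norm_apply_add_le hn0.ne hy hψ
  have hψ0 := hψi 0 hn0
  have hψn : 1 - (n + 2 / d) * ε ≤ ‖ψ (unitVec J n)‖ := by
    by_contra! hc
    have h3 : 2 / d * ε < ‖ψ (unitVec J 0)‖ - ‖ψ (unitVec J n)‖ := by linarith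
    have h4 : d / 2 ≤ ‖J y n‖ - ‖J y 0‖ := by linarith
    have h5 : 2 / d * ε * (d / 2) = ε := by field_simp
    have h6 : 0 < 2 / d * ε := by positivity
    nlinarith
  have hall : ∀ i ∈ Finset.range (n + 1), 1 - (n + 2 / d) * ε ≤ ‖ψ (unitVec J i)‖ := by
    intro i hi
    rcases Nat.lt_succ_iff_lt_or_eq.1 (Finset.mem_range.1 hi) with hi | rfl
    · have := hψi i hi
      have h6 : 0 < 2 / d * ε := by positivity
      linarith
    · exact hψn
  have h7 := h.sum_norm_mul_norm_le (Finset.range (n + 1)) x hψ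
  have h8 : ∑ i ∈ Finset.range (n + 1), ‖J x i‖ * (1 - (n + 2 / d) * ε) ≤ ‖x‖ :=
    (Finset.sum_le_sum fun i hi =>
      mul_le_mul_of_nonneg_left (hall i hi) (norm_nonneg _)).trans h7
  rw [← Finset.sum_mul] at h8
  linarith

end IsRISeqSpace
end AlternativeDaugavet

/-! ### Numerical index 1 and its passage to the alternative Daugavet property. -/

section NumericalIndexOne

variable {𝕜 : Type*} [RCLike 𝕜] {X : Type*} [NormedAddCommGroup X] [NormedSpace 𝕜 X]

/-- Nontriviality makes the set of values nonempty, so that `sSup` is a genuine supremum. -/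
theorem hasNumericalIndexOne_iff [Nontrivial X] :
    HasNumericalIndexOne 𝕜 X ↔ ∀ (T : X →L[𝕜] X) (r : ℝ), r < ‖T‖ →
      ∃ (x : X) (φ : StrongDual 𝕜 X), ‖x‖ = 1 ∧ ‖φ‖ = 1 ∧ φ x = 1 ∧ r < ‖φ (T x)‖ := by
  have hne : ∀ T : X →L[𝕜] X, {r : ℝ | ∃ (x : X) (φ : StrongDual 𝕜 X),
      ‖x‖ = 1 ∧ ‖φ‖ = 1 ∧ φ x = 1 ∧ r = ‖φ (T x)‖}.Nonempty := by
    intro T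
    obtain ⟨v, hv⟩ := exists_ne (0 : X)
    obtain ⟨φ, hφ, hφv⟩ := exists_dual_vector 𝕜 v (norm_ne_zero_iff.2 hv)
    have hv' : (‖v‖ : 𝕜) ≠ 0 := by simpa using hv
    refine ⟨_, (‖v‖ : 𝕜)⁻¹ • v, φ, ?_, hφ, ?_, rfl⟩
    · rw [norm_smul, norm_inv, RCLike.norm_ofReal, abs_norm,
        inv_mul_cancel₀ (norm_ne_zero_iff.2 hv)]
    · rw [map_smul, hφv, smul_eq_mul, inv_mul_cancel₀ hv']
  constructor
  · intro h T r hr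
    rw [← h T] at hr
    obtain ⟨_, ⟨x, φ, hx, hφ, hφx, rfl⟩, hlt⟩ := exists_lt_of_lt_csSup (hne T) hr
    exact ⟨x, φ, hx, hφ, hφx, hlt⟩
  · intro h T
    have hle : ∀ r ∈ {r : ℝ | ∃ (x : X) (φ : StrongDual 𝕜 X),
        ‖x‖ = 1 ∧ ‖φ‖ = 1 ∧ φ x = 1 ∧ r = ‖φ (T x)‖}, r ≤ ‖T‖ := by
      rintro _ ⟨x, φ, hx, hφ, -, rfl⟩
      simpa using φ.le_of_opNorm_le_of_le hφ.le (T.le_opNorm_of_le hx.le)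
    refine le_antisymm (csSup_le (hne T) hle) (le_of_forall_lt fun r hr => ?_)
    obtain ⟨x, φ, hx, hφ, hφx, hlt⟩ := h T r hr
    exact hlt.trans_le (le_csSup ⟨_, hle⟩ ⟨x, φ, hx, hφ, hφx, rfl⟩)

theorem HasNumericalIndexOne.of_linearIsometryEquiv [Nontrivial X] {Y : Type*}
    [NormedAddCommGroup Y] [NormedSpace 𝕜 Y] (e : X ≃ₗᵢ[𝕜] Y) (hY : HasNumericalIndexOne 𝕜 Y) :
    HasNumericalIndexOne 𝕜 X := by
  have : Nontrivial Y := e.symm.toEquiv.nontrivial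
  rw [hasNumericalIndexOne_iff] at hY ⊢
  intro T r hr
  let e' : X →L[𝕜] Y := e.toContinuousLinearEquiv
  let e'' : Y →L[𝕜] X := e.symm.toContinuousLinearEquiv
  have hT : ‖T‖ ≤ ‖e' ∘L T ∘L e''‖ := by
    refine T.opNorm_le_bound (norm_nonneg _) fun x => ?_
    have := (e' ∘L T ∘L e'').le_opNorm (e x)
    simpa [e', e''] using this
  obtain ⟨y, φ, hy, hφ, hφy, hlt⟩ := hY (e' ∘L T ∘L e'') r (hr.trans_le hT)
  refine ⟨e.symm y, φ ∘L e', by simpa using hy, ?_, by simpa [e'] using hφy, hlt⟩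
  rw [← hφ]
  refine le_antisymm (ContinuousLinearMap.opNorm_le_bound _ (norm_nonneg _) fun x => ?_)
    (ContinuousLinearMap.opNorm_le_bound _ (norm_nonneg _) fun z => ?_)
  · simpa [e'] using φ.le_opNorm (e x)
  · simpa [e'] using (φ ∘L e').le_opNorm (e.symm z)

theorem HasNumericalIndexOne.hasAlternativeDaugavet [Nontrivial X]
    (h : HasNumericalIndexOne 𝕜 X) : HasAlternativeDaugavet 𝕜 X := by
  intro φ e
  set T := φ.smulRight e with hT
  have hub : ∀ θ : 𝕜, ‖θ‖ = 1 → ‖ContinuousLinearMap.id 𝕜 X + θ • T‖ ≤ 1 + ‖T‖ := by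
    intro θ hθ
    refine (norm_add_le _ _).trans (add_le_add ContinuousLinearMap.norm_id_le ?_)
    rw [norm_smul, hθ, one_mul]
  refine ⟨?_, ?_⟩
  -- Compactness supplies the maximising θ. Each pair x, ψ gives a phase c with ‖Id + cT‖ ≥ 1 +
  -- |ψ(Tx)|, which the maximum dominates.
  · have hc : IsCompact (Metric.sphere (0 : 𝕜) 1) := isCompact_sphere _ _
    obtain ⟨θ, hθ, hmax⟩ := hc.exists_isMaxOn (f := fun θ : 𝕜 => ‖ContinuousLinearMap.id 𝕜 X + θ • T‖)
      ⟨1, by simp⟩ (by fun_prop)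
    rw [mem_sphere_zero_iff_norm] at hθ
    refine ⟨θ, hθ, le_antisymm ?_ (hub θ hθ)⟩
    refine le_of_forall_lt fun r hr => ?_
    obtain ⟨x, ψ, hx, hψ, hψx, hlt⟩ := hasNumericalIndexOne_iff.1 h T (r - 1) (by linarith)
    obtain ⟨c, hc, hc'⟩ := exists_phase (ψ (T x))
    have h1 : ψ ((ContinuousLinearMap.id 𝕜 X + c • T) x) = ((1 + ‖ψ (T x)‖ : ℝ) : 𝕜) := by
      rw [RCLike.ofReal_add, hc']
      simp [hψx]
    have h2 := ψ.le_of_opNorm_le_of_le hψ.le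
      ((ContinuousLinearMap.id 𝕜 X + c • T).le_opNorm_of_le hx.le)
    rw [h1, RCLike.norm_of_nonneg (by positivity)] at h2
    have h3 : ‖ContinuousLinearMap.id 𝕜 X + c • T‖ ≤ ‖ContinuousLinearMap.id 𝕜 X + θ • T‖ :=
      hmax (by simpa using hc)
    linarith
  · rintro _ ⟨θ, hθ, rfl⟩
    exact hub θ hθ

end NumericalIndexOne

/-! ### Identification of X with c₀ or ℓ¹. -/

section Classification

variable {𝕜 : Type*} [RCLike 𝕜] {X : Type*} [NormedAddCommGroup X] [NormedSpace 𝕜 X]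
  {Y : Type*} [NormedAddCommGroup Y] [NormedSpace 𝕜 Y]
  {J : X →ₗ[𝕜] (ℕ → 𝕜)} {K : Y →ₗ[𝕜] (ℕ → 𝕜)}

/-- Two contractive inclusions are inverse to each other by injectivity, hence isometric. -/
theorem sameSeqSpace_of_exists (hJ : Function.Injective J) (hK : Function.Injective K)
    (h1 : ∀ x, ∃ y, K y = J x ∧ ‖y‖ ≤ ‖x‖) (h2 : ∀ y, ∃ x, J x = K y ∧ ‖x‖ ≤ ‖y‖) :
    SameSeqSpace J K := by
  choose f hf hf' using h1
  let F : X →ₗ[𝕜] Y :=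
    { toFun := f
      map_add' := fun a b => hK (by simp [hf])
      map_smul' := fun c a => hK (by simp [hf]) }
  have hbij : Function.Bijective F := by
    refine ⟨fun a b hab => hJ ?_, fun y => ?_⟩
    · rw [← hf, ← hf]
      exact congrArg K hab
    · obtain ⟨x, hx, -⟩ := h2 y
      exact ⟨x, hK ((hf x).trans hx)⟩
  refine ⟨⟨LinearEquiv.ofBijective F hbij, fun x => ?_⟩, hf⟩
  refine le_antisymm (hf' x) ?_
  obtain ⟨z, hz, hz'⟩ := h2 (f x)
  rwa [hJ (hz.trans (hf x))] at hz'

theorem c0Seq_injective : Function.Injective (c0Seq 𝕜) := DFunLike.coe_injective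

theorem l1Seq_injective : Function.Injective (l1Seq 𝕜) := Subtype.val_injective

@[simp] theorem c0Seq_apply (f : C₀(ℕ, 𝕜)) (n : ℕ) : c0Seq 𝕜 f n = f n := rfl

@[simp] theorem l1Seq_apply (f : lp (fun _ : ℕ => 𝕜) 1) (n : ℕ) : l1Seq 𝕜 f n = f n := rfl

theorem exists_c0Seq_eq {f : ℕ → 𝕜} (hf : Filter.Tendsto f Filter.atTop (nhds 0)) :
    ∃ g, c0Seq 𝕜 g = f :=
  ⟨⟨⟨f, continuous_of_discreteTopology⟩, by
    rwa [Filter.cocompact_eq_cofinite, Nat.cofinite_eq_atTop]⟩, rfl⟩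

theorem tendsto_c0Seq (f : C₀(ℕ, 𝕜)) : Filter.Tendsto (c0Seq 𝕜 f) Filter.atTop (nhds 0) := by
  have := f.zero_at_infty'
  rwa [Filter.cocompact_eq_cofinite, Nat.cofinite_eq_atTop] at this

theorem norm_c0_le {f : C₀(ℕ, 𝕜)} {C : ℝ} (hC : 0 ≤ C) (h : ∀ n, ‖f n‖ ≤ C) : ‖f‖ ≤ C := by
  rw [← ZeroAtInftyContinuousMap.norm_toBCF_eq_norm]
  exact (BoundedContinuousFunction.norm_le hC).2 h

theorem norm_c0_apply_le (f : C₀(ℕ, 𝕜)) (n : ℕ) : ‖f n‖ ≤ ‖f‖ := by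
  rw [← ZeroAtInftyContinuousMap.norm_toBCF_eq_norm]
  exact f.toBCF.norm_coe_le_norm n

theorem exists_l1Seq_eq {f : ℕ → 𝕜} {C : ℝ}
    (hf : ∀ n, ∑ i ∈ Finset.range n, ‖f i‖ ≤ C) : ∃ g, l1Seq 𝕜 g = f ∧ ‖g‖ ≤ C := by
  have hs : Summable fun i => ‖f i‖ := summable_of_sum_range_le (fun _ => norm_nonneg _) hf
  refine ⟨⟨f, memℓp_gen (by simpa using hs)⟩, rfl, ?_⟩
  rw [lp.norm_eq_tsum_rpow (by norm_num)]
  simpa using hs.tsum_le_of_sum_range_le hf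

theorem norm_l1_eq (f : lp (fun _ : ℕ => 𝕜) 1) : ‖f‖ = ∑' n, ‖f n‖ := by
  rw [lp.norm_eq_tsum_rpow (by norm_num)]
  simp

theorem summable_norm_l1 (f : lp (fun _ : ℕ => 𝕜) 1) : Summable fun n => ‖f n‖ := by
  simpa using (lp.memℓp f).summable (by norm_num)

theorem IsKotheSeqSpace.norm_sum_smul_unitVec_le (h : IsKotheSeqSpace J)
    (h1 : ∀ n, ‖∑ i ∈ Finset.range n, unitVec J i‖ ≤ 1) {f : ℕ → 𝕜} {C : ℝ} (hC : 0 ≤ C)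
    {s : Finset ℕ} (hf : ∀ i ∈ s, ‖f i‖ ≤ C) :
    ‖∑ i ∈ s, f i • unitVec J i‖ ≤ C := by
  obtain ⟨n, hn⟩ := s.exists_nat_subset_range
  calc ‖∑ i ∈ s, f i • unitVec J i‖
      ≤ ‖(C : 𝕜) • ∑ i ∈ Finset.range n, unitVec J i‖ := by
        refine h.norm_le_of_le fun i => ?_
        rw [Finset.smul_sum, h.apply_sum_smul_unitVec,
          h.apply_sum_smul_unitVec (Finset.range n) (fun _ => (C : 𝕜))]
        by_cases hi : i ∈ s
        · simpa [hi, Finset.mem_range.1 (hn hi), abs_of_nonneg hC] using hf i hi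
        · simp [hi]
    _ ≤ C := by
        rw [norm_smul, RCLike.norm_of_nonneg hC]
        exact mul_le_of_le_one_right hC (h1 n)

namespace IsRISeqSpace

/-- Diagonal argument: if |x| ≥ δ along indices a_k and (u_k) is dense, restrict x to the set B of
those a_k where u_k is smaller than δ/2. The restriction lies in X by solidity, yet differs from
each u_k by at least δ/2 at a_k. -/
theorem tendsto_zero [TopologicalSpace.SeparableSpace X] (h : IsRISeqSpace J) (x : X) :
    Filter.Tendsto (J x) Filter.atTop (nhds 0) := by
  by_contra hx
  rw [Metric.tendsto_nhds] at hx
  push Not at hx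
  obtain ⟨δ, hδ, hfreq⟩ := hx
  simp only [dist_zero_right] at hfreq
  obtain ⟨a, ha, haδ⟩ := Filter.extraction_of_frequently_atTop hfreq
  have : Nonempty X := ⟨x⟩
  let u := TopologicalSpace.denseSeq X
  classical
  let B : Set ℕ := {n | ∃ k, a k = n ∧ ‖J (u k) (a k)‖ < δ / 2}
  obtain ⟨w, hw, -⟩ := h.solid (B.indicator (J x)) x fun n => norm_indicator_le_norm_self _ _
  obtain ⟨k, hk⟩ :=
    (TopologicalSpace.denseRange_denseSeq X).exists_dist_lt w (half_pos hδ)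
  have hlt : ‖J (u k - w) (a k)‖ < δ / 2 :=
    (h.subset_linfty _ _).trans_lt (by rwa [dist_comm, dist_eq_norm] at hk)
  rw [map_sub, Pi.sub_apply, hw] at hlt
  by_cases hB : ‖J (u k) (a k)‖ < δ / 2
  · have hmem : a k ∈ B := ⟨k, rfl, hB⟩
    rw [Set.indicator_of_mem hmem] at hlt
    have := norm_sub_norm_le (J x (a k)) (J (u k) (a k))
    rw [norm_sub_rev] at this
    linarith [haδ k]
  · have hmem : a k ∉ B := by
      rintro ⟨l, hl, hl'⟩
      rw [ha.injective hl] at hl'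
      exact hB hl'
    rw [Set.indicator_of_notMem hmem, sub_zero] at hlt
    exact hB hlt

/-- On finitely supported vectors the norm is at most the supremum norm, so the truncations of g are
Cauchy in X. -/
theorem exists_eq_c0 [CompleteSpace X] (h : IsRISeqSpace J)
    (h1 : ∀ n, ‖∑ i ∈ Finset.range n, unitVec J i‖ ≤ 1) (g : C₀(ℕ, 𝕜)) :
    ∃ x : X, J x = c0Seq 𝕜 g ∧ ‖x‖ ≤ ‖g‖ := by
  let s : ℕ → X := fun n => ∑ i ∈ Finset.range n, g i • unitVec J i
  have hs : CauchySeq s := by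
    rw [Metric.cauchySeq_iff']
    intro ε hε
    obtain ⟨N, hN⟩ := Filter.eventually_atTop.1
      ((Metric.tendsto_nhds.1 (tendsto_c0Seq g)) (ε / 2) (by positivity))
    refine ⟨N, fun n hn => ?_⟩
    rw [dist_eq_norm, ← Finset.sum_Ico_eq_sub _ hn]
    refine (h.norm_sum_smul_unitVec_le h1 (by positivity : 0 ≤ ε / 2) fun i hi => ?_).trans_lt
      (by linarith)
    simpa using (hN i (Finset.mem_Ico.1 hi).1).le
  obtain ⟨x, hx⟩ := cauchySeq_tendsto_of_complete hs
  refine ⟨x, ?_, ?_⟩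
  · ext n
    refine tendsto_nhds_unique (((h.coord n).continuous.tendsto x).comp hx) ?_
    refine tendsto_const_nhds.congr' ?_
    filter_upwards [Filter.eventually_gt_atTop n] with m hm
    simp [s, h.apply_unitVec, Pi.single_apply, hm]
  · refine le_of_tendsto hx.norm (Filter.Eventually.of_forall fun n => ?_)
    exact h.norm_sum_smul_unitVec_le h1 (norm_nonneg g) fun i _ => norm_c0_apply_le g i

/-- The converse part of the classification. -/
theorem sameSeqSpace_of_hasAlternativeDaugavet [CompleteSpace X]
    [TopologicalSpace.SeparableSpace X] (h : IsRISeqSpace J) (hX : HasAlternativeDaugavet 𝕜 X) :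
    SameSeqSpace J (c0Seq 𝕜) ∨ SameSeqSpace J (l1Seq 𝕜) := by
  rcases le_or_gt ‖unitVec J 0 + unitVec J 1‖ 1 with h2 | h2
  · left
    have h1 : ∀ n, ‖∑ i ∈ Finset.range n, unitVec J i‖ ≤ 1 := by
      intro n
      induction n with
      | zero => simp
      | succ n ih =>
        rcases n.eq_zero_or_pos with rfl | hn
        · simp [h.norm_unitVec]
        · exact h.norm_sum_unitVec_succ_le hX h2 hn ih
    refine sameSeqSpace_of_exists h.injective c0Seq_injective (fun x => ?_) (h.exists_eq_c0 h1)
    obtain ⟨g, hg⟩ := exists_c0Seq_eq (h.tendsto_zero x)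
    refine ⟨g, hg, norm_c0_le (norm_nonneg x) fun n => ?_⟩
    rw [← c0Seq_apply, hg]
    exact h.subset_linfty x n
  · right
    have h1 : ∀ n, ∀ x : X, ∑ i ∈ Finset.range n, ‖J x i‖ ≤ ‖x‖ := by
      intro n
      induction n with
      | zero => simp
      | succ n ih =>
        rcases n.eq_zero_or_pos with rfl | hn
        · simpa using fun x => h.subset_linfty x 0
        · exact h.sum_range_succ_norm_le hX h2 hn ih
    exact sameSeqSpace_of_exists h.injective l1Seq_injective
      (fun x => exists_l1Seq_eq fun n => h1 n x) h.l1_subset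

theorem nontrivial (h : IsRISeqSpace J) : Nontrivial X :=
  ⟨unitVec J 0, 0, fun h0 => by simpa [h0] using h.norm_unitVec 0⟩

end IsRISeqSpace
end Classification

/-! ### Separability and the coefficients of Köthe dual functionals. -/

section Separability

variable {𝕜 : Type*} [RCLike 𝕜] {X : Type*} [NormedAddCommGroup X] [NormedSpace 𝕜 X]
  {J : X →ₗ[𝕜] (ℕ → 𝕜)}

theorem separableSpace_of_tendsto_sum
    (h : ∀ x, Filter.Tendsto (fun n => ∑ i ∈ Finset.range n, J x i • unitVec J i)
      Filter.atTop (nhds x)) : TopologicalSpace.SeparableSpace X := by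
  rw [← TopologicalSpace.isSeparable_univ_iff]
  refine ((Set.countable_range (unitVec J)).isSeparable.span (R := 𝕜)).closure.mono fun x _ => ?_
  refine mem_closure_of_tendsto (h x) (Filter.Eventually.of_forall fun n => ?_)
  exact Submodule.sum_mem _ fun i _ => Submodule.smul_mem _ _ (Submodule.subset_span ⟨i, rfl⟩)

/-- Testing on e_n identifies the unnamed coefficients. Only unit vectors are required in the range,
so the lemma also applies to `kotheDualSeq J`. -/
theorem hasSum_kotheDualSeq (hJ : ∀ n, ∃ x : X, J x = Pi.single n 1) (φ : KotheDual J) (x : X) :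
    HasSum (fun n => J x n * kotheDualSeq J φ n) (KotheDual.toDual J φ x) := by
  obtain ⟨g, hg⟩ : ∃ g : ℕ → 𝕜, ∀ x : X, HasSum (fun n => J x n * g n) (KotheDual.toDual J φ x) :=
    φ.2
  have : kotheDualSeq J φ = g := by
    ext n
    refine (hg (unitVec J n)).unique ?_
    rw [apply_unitVec_of_exists (hJ n)]
    convert hasSum_single (f := fun m => (Pi.single n 1 : ℕ → 𝕜) m * g m) n ?_ using 1
    · simp
    · intro m hm; simp [hm]
  rw [this]
  exact hg x

theorem exists_toDual_eq {φ : StrongDual 𝕜 X} {g : ℕ → 𝕜}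
    (h : ∀ x, HasSum (fun n => J x n * g n) (φ x)) :
    ∃ Φ : KotheDual J, KotheDual.toDual J Φ = φ :=
  ⟨⟨φ, g, h⟩, rfl⟩

theorem norm_kotheDual_toDual (φ : KotheDual J) : ‖KotheDual.toDual J φ‖ = ‖φ‖ :=
  (KotheDual.toDual J).norm_map φ

theorem kotheDualSeq_injective (hJ : ∀ n, ∃ x : X, J x = Pi.single n 1) :
    Function.Injective (kotheDualSeq J) := by
  intro φ ψ h
  refine (KotheDual.toDual J).injective (ContinuousLinearMap.ext fun x => ?_)
  refine (hasSum_kotheDualSeq hJ φ x).unique ?_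
  rw [h]
  exact hasSum_kotheDualSeq hJ ψ x

end Separability

/-! ### The space c₀: rearrangement invariance, separability, numerical index. -/

section NullSequences

variable {𝕜 : Type*} [RCLike 𝕜]

theorem tendsto_zero_of_support_finite {f : ℕ → 𝕜} (hf : (Function.support f).Finite) :
    Filter.Tendsto f Filter.atTop (nhds 0) := by
  refine tendsto_const_nhds.congr' ?_
  rw [← Nat.cofinite_eq_atTop]
  filter_upwards [hf.compl_mem_cofinite] with n hn
  simpa using Eq.symm (by simpa using hn : f n = 0)

theorem mem_range_c0Seq {f : ℕ → 𝕜} :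
    f ∈ LinearMap.range (c0Seq 𝕜) ↔ Filter.Tendsto f Filter.atTop (nhds 0) :=
  ⟨by rintro ⟨g, rfl⟩; exact tendsto_c0Seq g, fun h => exists_c0Seq_eq h⟩

theorem isKotheSeqSpace_c0Seq : IsKotheSeqSpace (c0Seq 𝕜) where
  injective := c0Seq_injective
  solid f g hfg := by
    obtain ⟨x, hx⟩ := exists_c0Seq_eq (squeeze_zero_norm hfg
      (by simpa using (tendsto_c0Seq g).norm))
    refine ⟨x, hx, norm_c0_le (norm_nonneg _) fun n => ?_⟩
    rw [← c0Seq_apply, hx]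
    exact (hfg n).trans (norm_c0_apply_le g n)
  indicator_mem A hA := exists_c0Seq_eq <| tendsto_zero_of_support_finite <|
    hA.subset (Set.support_indicator_subset)

theorem exists_c0Seq_single (n : ℕ) : ∃ x, c0Seq 𝕜 x = Pi.single n 1 :=
  ⟨_, isKotheSeqSpace_c0Seq.apply_unitVec n⟩

theorem comp_perm_tendsto {f : ℕ → 𝕜} (τ : Equiv.Perm ℕ)
    (hf : Filter.Tendsto f Filter.atTop (nhds 0)) :
    Filter.Tendsto (f ∘ τ) Filter.atTop (nhds 0) := by
  rw [← Nat.cofinite_eq_atTop] at *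
  exact hf.comp τ.injective.tendsto_cofinite

/-- The coordinate functionals of `c₀`. -/
def c0Coord (n : ℕ) : StrongDual 𝕜 C₀(ℕ, 𝕜) :=
  LinearMap.mkContinuous ((LinearMap.proj n).comp (c0Seq 𝕜)) 1 fun x => by
    simpa using norm_c0_apply_le x n

@[simp] theorem c0Coord_apply (n : ℕ) (x : C₀(ℕ, 𝕜)) : c0Coord n x = x n := rfl

theorem norm_c0Coord_le (n : ℕ) : ‖c0Coord (𝕜 := 𝕜) n‖ ≤ 1 :=
  LinearMap.mkContinuous_norm_le _ zero_le_one _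

theorem hasSum_mul_single (f : ℕ → 𝕜) (n : ℕ) :
    HasSum (fun m => f m * (Pi.single n 1 : ℕ → 𝕜) m) (f n) := by
  convert hasSum_single (f := fun m => f m * (Pi.single n 1 : ℕ → 𝕜) m) n ?_ using 1
  · simp
  · intro m hm; simp [hm]

theorem norm_le_of_c0Seq_comp_perm {τ : Equiv.Perm ℕ} {x y : C₀(ℕ, 𝕜)}
    (h : c0Seq 𝕜 y = c0Seq 𝕜 x ∘ τ) : ‖y‖ ≤ ‖x‖ :=
  norm_c0_le (norm_nonneg _) fun n => by
    rw [← c0Seq_apply, h]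
    exact norm_c0_apply_le x _

theorem exists_kotheDual_c0_single (n : ℕ) :
    ∃ Φ : KotheDual (c0Seq 𝕜), kotheDualSeq (c0Seq 𝕜) Φ = Pi.single n 1 ∧ ‖Φ‖ ≤ 1 := by
  obtain ⟨Φ, hΦ⟩ := exists_toDual_eq (J := c0Seq 𝕜) (φ := c0Coord n) (g := Pi.single n 1)
    fun x => hasSum_mul_single (c0Seq 𝕜 x) n
  refine ⟨Φ, ?_, by rw [← norm_kotheDual_toDual, hΦ]; exact norm_c0Coord_le n⟩
  ext m
  change KotheDual.toDual _ Φ (unitVec (c0Seq 𝕜) m) = _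
  rw [hΦ, c0Coord_apply, ← c0Seq_apply, isKotheSeqSpace_c0Seq.apply_unitVec]
  simp [Pi.single_apply, eq_comm]

theorem exists_kotheDual_c0_single' (n : ℕ) :
    ∃ Φ, kotheDualSeq (c0Seq 𝕜) Φ = Pi.single n 1 :=
  (exists_kotheDual_c0_single n).imp fun _ h => h.1

theorem norm_unitVec_kotheDual_c0_le (n : ℕ) : ‖unitVec (kotheDualSeq (c0Seq 𝕜)) n‖ ≤ 1 := by
  obtain ⟨Φ, hΦ, hΦ'⟩ := exists_kotheDual_c0_single (𝕜 := 𝕜) n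
  rwa [kotheDualSeq_injective exists_c0Seq_single
    ((apply_unitVec_of_exists ⟨Φ, hΦ⟩).trans hΦ.symm)]

theorem norm_kotheBidualSeq_c0_le (ψ : KotheBidual (c0Seq 𝕜)) (n : ℕ) :
    ‖kotheBidualSeq (c0Seq 𝕜) ψ n‖ ≤ ‖ψ‖ := by
  have := (KotheDual.toDual _ ψ).le_opNorm_of_le (norm_unitVec_kotheDual_c0_le (𝕜 := 𝕜) n)
  rwa [norm_kotheDual_toDual, mul_one] at this

theorem sum_norm_kotheDualSeq_c0_le (φ : KotheDual (c0Seq 𝕜)) (s : Finset ℕ) :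
    ∑ i ∈ s, ‖kotheDualSeq (c0Seq 𝕜) φ i‖ ≤ ‖φ‖ := by
  choose a ha ha' using fun i => exists_phase (kotheDualSeq (c0Seq 𝕜) φ i)
  set x : C₀(ℕ, 𝕜) := ∑ i ∈ s, a i • unitVec (c0Seq 𝕜) i
  have hx : ‖x‖ ≤ 1 := by
    refine norm_c0_le zero_le_one fun n => ?_
    rw [← c0Seq_apply, isKotheSeqSpace_c0Seq.apply_sum_smul_unitVec]
    split_ifs <;> simp [ha]
  have h1 := (KotheDual.toDual _ φ).le_opNorm_of_le hx
  have h2 : KotheDual.toDual _ φ x = ((∑ i ∈ s, ‖kotheDualSeq (c0Seq 𝕜) φ i‖ : ℝ) : 𝕜) := by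
    rw [map_sum, RCLike.ofReal_sum]
    refine Finset.sum_congr rfl fun i _ => ?_
    rw [ha', map_smul]
    rfl
  rw [h2, RCLike.norm_of_nonneg (Finset.sum_nonneg fun _ _ => norm_nonneg _), norm_kotheDual_toDual] at h1
  simpa using h1

/-- Functionals in the Köthe dual have coefficients with ℓ¹ norm at most ‖φ‖. With
`norm_kotheBidualSeq_c0_le` this makes the norm of X'' the supremum norm. -/
theorem norm_kotheBidual_c0_le {ψ : KotheBidual (c0Seq 𝕜)} {C : ℝ} (hC : 0 ≤ C)
    (h : ∀ n, ‖kotheBidualSeq (c0Seq 𝕜) ψ n‖ ≤ C) : ‖ψ‖ ≤ C := by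
  rw [← norm_kotheDual_toDual]
  refine ContinuousLinearMap.opNorm_le_bound _ hC fun φ => ?_
  have hs := hasSum_kotheDualSeq (J := kotheDualSeq (c0Seq 𝕜)) exists_kotheDual_c0_single' ψ φ
  refine le_of_tendsto (Filter.Tendsto.norm hs) (Filter.Eventually.of_forall fun s => ?_)
  calc _ ≤ ∑ i ∈ s, ‖kotheDualSeq (c0Seq 𝕜) φ i‖ * C := by
        refine (norm_sum_le _ _).trans (Finset.sum_le_sum fun i _ => ?_)
        rw [norm_mul]
        exact mul_le_mul_of_nonneg_left (h i) (norm_nonneg _)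
    _ ≤ C * ‖φ‖ := by
        rw [← Finset.sum_mul, mul_comm]
        exact mul_le_mul_of_nonneg_left (sum_norm_kotheDualSeq_c0_le φ s) hC

theorem exists_kotheBidual_c0_single (n : ℕ) :
    ∃ ψ, kotheBidualSeq (c0Seq 𝕜) ψ = Pi.single n 1 := by
  obtain ⟨ψ, hψ⟩ := exists_toDual_eq (J := kotheDualSeq (c0Seq 𝕜))
    (φ := (ContinuousLinearMap.apply 𝕜 𝕜 (unitVec (c0Seq 𝕜) n)) ∘L
      (KotheDual.toDual (c0Seq 𝕜)).toContinuousLinearMap) (g := Pi.single n 1)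
    fun φ => hasSum_mul_single (kotheDualSeq (c0Seq 𝕜) φ) n
  refine ⟨ψ, ?_⟩
  ext m
  change KotheDual.toDual _ ψ (unitVec (kotheDualSeq (c0Seq 𝕜)) m) = _
  rw [hψ]
  change kotheDualSeq (c0Seq 𝕜) (unitVec (kotheDualSeq (c0Seq 𝕜)) m) n = _
  rw [apply_unitVec_of_exists (exists_kotheDual_c0_single' m)]
  simp [Pi.single_apply, eq_comm]

theorem mem_inKotheBidual_c0 {ψ : KotheBidual (c0Seq 𝕜)} :
    ψ ∈ inKotheBidual (c0Seq 𝕜) ↔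
      Filter.Tendsto (kotheBidualSeq (c0Seq 𝕜) ψ) Filter.atTop (nhds 0) :=
  mem_range_c0Seq

/-- For the supremum norm, truncations approximate null sequences, and uniform limits of null
sequences are null. -/
theorem inKotheBidual_c0_eq : inKotheBidual (c0Seq 𝕜) = simpleClosure (c0Seq 𝕜) := by
  apply le_antisymm
  · intro ψ hψ
    rw [mem_inKotheBidual_c0] at hψ
    refine Metric.mem_closure_iff.2 fun ε hε => ?_
    obtain ⟨N, hN⟩ := Filter.eventually_atTop.1
      ((Metric.tendsto_nhds.1 hψ) (ε / 2) (by positivity))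
    set p : KotheBidual (c0Seq 𝕜) := ∑ i ∈ Finset.range N,
      kotheBidualSeq (c0Seq 𝕜) ψ i • unitVec (kotheBidualSeq (c0Seq 𝕜)) i with hp
    have hpn : ∀ n, kotheBidualSeq (c0Seq 𝕜) p n =
        if n < N then kotheBidualSeq (c0Seq 𝕜) ψ n else 0 := by
      intro n
      simp [hp, apply_unitVec_of_exists (exists_kotheBidual_c0_single _), Pi.single_apply]
    refine ⟨p, Submodule.subset_span ?_, ?_⟩
    · refine (Finset.finite_toSet (Finset.range N)).subset fun n hn => ?_
      rw [Function.mem_support, hpn] at hn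
      by_contra hc
      simp_all
    · rw [dist_eq_norm]
      refine (norm_kotheBidual_c0_le (by positivity : 0 ≤ ε / 2) fun n => ?_).trans_lt
        (by linarith)
      rw [map_sub, Pi.sub_apply, hpn]
      split_ifs with hn
      · simp [(half_pos hε).le]
      · simpa using (hN n (not_lt.1 hn)).le
  · refine Submodule.topologicalClosure_minimal _ (Submodule.span_le.2 fun ψ hψ =>
      mem_inKotheBidual_c0.2 (tendsto_zero_of_support_finite hψ)) ?_
    refine isClosed_of_closure_subset fun ψ hψ => ?_
    rw [SetLike.mem_coe, mem_inKotheBidual_c0, Metric.tendsto_nhds]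
    intro ε hε
    obtain ⟨p, hp, hψp⟩ := Metric.mem_closure_iff.1 hψ (ε / 2) (by positivity)
    rw [SetLike.mem_coe, mem_inKotheBidual_c0, Metric.tendsto_nhds] at hp
    filter_upwards [hp (ε / 2) (by positivity)] with n hn
    have h1 := norm_kotheBidualSeq_c0_le (ψ - p) n
    rw [dist_eq_norm] at hψp
    rw [map_sub, Pi.sub_apply, ← dist_eq_norm] at h1
    have h2 := dist_triangle (kotheBidualSeq (c0Seq 𝕜) ψ n) (kotheBidualSeq (c0Seq 𝕜) p n) 0
    linarith

variable (𝕜) in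
theorem isRISeqSpace_c0Seq : IsRISeqSpace (c0Seq 𝕜) where
  toIsKotheSeqSpace := isKotheSeqSpace_c0Seq
  perm_mem_iff τ f := by
    rw [mem_range_c0Seq, mem_range_c0Seq]
    refine ⟨comp_perm_tendsto τ.symm, fun h => ?_⟩
    simpa [Function.comp_assoc] using comp_perm_tendsto τ h
  norm_perm τ x y h := by
    refine le_antisymm (norm_le_of_c0Seq_comp_perm h) (norm_le_of_c0Seq_comp_perm (τ := τ) ?_)
    simp [h, Function.comp_assoc]
  norming x := by
    constructor
    · rintro _ ⟨φ, -, hφ, rfl⟩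
      simpa using φ.le_of_opNorm_le hφ x
    · intro b hb
      have h1 : ∀ n, ‖x n‖ ≤ b := fun n => hb
        ⟨c0Coord n, ⟨Pi.single n 1, fun y => hasSum_mul_single (c0Seq 𝕜 y) n⟩,
          norm_c0Coord_le n, rfl⟩
      exact norm_c0_le ((norm_nonneg _).trans (h1 0)) h1
  maximal_or_minimal := Or.inr inKotheBidual_c0_eq
  l1_subset f := by
    have hle : ∀ n, ‖f n‖ ≤ ‖f‖ := fun n => lp.norm_apply_le_norm (by simp) f n
    obtain ⟨x, hx⟩ := exists_c0Seq_eq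
      (tendsto_zero_iff_norm_tendsto_zero.2 (summable_norm_l1 f).tendsto_atTop_zero)
    refine ⟨x, hx, norm_c0_le (norm_nonneg f) fun n => ?_⟩
    rw [← c0Seq_apply, hx]
    exact hle n
  subset_linfty := norm_c0_apply_le

variable (𝕜) in
theorem separableSpace_c0 : TopologicalSpace.SeparableSpace C₀(ℕ, 𝕜) := by
  refine separableSpace_of_tendsto_sum (J := c0Seq 𝕜) fun x => ?_
  rw [Metric.tendsto_atTop]
  intro ε hε
  obtain ⟨N, hN⟩ := Filter.eventually_atTop.1
    ((Metric.tendsto_nhds.1 (tendsto_c0Seq x)) (ε / 2) (by positivity))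
  refine ⟨N, fun n hn => ?_⟩
  rw [dist_eq_norm]
  refine (norm_c0_le (by positivity : 0 ≤ ε / 2) fun m => ?_).trans_lt (by linarith)
  rw [← c0Seq_apply, map_sub, Pi.sub_apply, isKotheSeqSpace_c0Seq.apply_sum_smul_unitVec]
  split_ifs with hm
  · simp [(half_pos hε).le]
  · simpa using (hN m (hn.trans (by simpa using hm))).le

variable (𝕜) in
-- Once |(Tx)(n)| is nearly ‖T‖, the n-th coordinate of x can be made unimodular without decreasing
-- this value; the n-th coordinate functional, rotated, then norms the new vector.
theorem hasNumericalIndexOne_c0 : HasNumericalIndexOne 𝕜 C₀(ℕ, 𝕜) := by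
  have := (isRISeqSpace_c0Seq 𝕜).nontrivial
  rw [hasNumericalIndexOne_iff]
  intro T r hr
  have hunit : ∀ n m, unitVec (c0Seq 𝕜) n m = (Pi.single n 1 : ℕ → 𝕜) m := fun n m => by
    rw [← c0Seq_apply, isKotheSeqSpace_c0Seq.apply_unitVec]
  obtain ⟨x, n, hx, hxn⟩ : ∃ (x : C₀(ℕ, 𝕜)) (n : ℕ), ‖x‖ ≤ 1 ∧ r < ‖T x n‖ := by
    rcases lt_or_ge r 0 with h0 | h0
    · exact ⟨0, 0, by simp, h0.trans_le (norm_nonneg _)⟩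
    obtain ⟨x, hx, hlt⟩ := T.exists_lt_apply_of_lt_opNorm hr
    by_contra! hc
    exact absurd (norm_c0_le h0 fun n => hc x n hx.le) (not_le.2 hlt)
  -- As a function of the `n`-th coordinate of `x`, `T x n` is affine.
  set z := x - x n • unitVec (c0Seq 𝕜) n with hz
  set u := T (unitVec (c0Seq 𝕜) n) n with hu
  have hTx : T x n = T z n + x n * u := by
    simp [hz, hu]
  obtain ⟨a, ha, ha'⟩ := exists_phase u
  obtain ⟨b, hb, hb'⟩ := exists_phase (T z n)
  have hb0 : b ≠ 0 := by rintro rfl; simp at hb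
  -- This phase aligns ζu with (Tz)(n), so their moduli add up.
  set ζ := b⁻¹ * a with hζdef
  have hζ : ‖ζ‖ = 1 := by simp [hζdef, ha, hb]
  have hζ0 : ζ ≠ 0 := by intro h; simp [h] at hζ
  set y := z + ζ • unitVec (c0Seq 𝕜) n with hy
  have hym : ∀ m, y m = if m = n then ζ else x m := by
    intro m
    rw [hy, hz]
    by_cases hm : m = n
    · subst hm; simp [hunit]
    · simp [hunit, hm]
  have hyn : y n = ζ := by simp [hym]
  have hy1 : ‖y‖ ≤ 1 := by
    refine norm_c0_le zero_le_one fun m => ?_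
    rw [hym]
    split_ifs
    · exact hζ.le
    · exact (norm_c0_apply_le x m).trans hx
  refine ⟨y, ζ⁻¹ • c0Coord n, le_antisymm hy1 ?_, le_antisymm ?_ ?_, ?_, ?_⟩
  · rw [← hζ, ← hyn]; exact norm_c0_apply_le y n
  · rw [norm_smul, norm_inv, hζ]; simpa using norm_c0Coord_le n
  · have := (ζ⁻¹ • c0Coord n : StrongDual 𝕜 C₀(ℕ, 𝕜)).le_opNorm_of_le hy1
    simpa [hyn, hζ0] using this
  · simp [hyn, hζ0]
  · have h1 : T y n = b⁻¹ * ((‖T z n‖ + ‖u‖ : ℝ) : 𝕜) := by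
      rw [RCLike.ofReal_add, ha', hb', mul_add, inv_mul_cancel_left₀ hb0, ← mul_assoc]
      simp [hy, hu, hζdef]
    have h2 : ‖(ζ⁻¹ • c0Coord n : StrongDual 𝕜 C₀(ℕ, 𝕜)) (T y)‖ = ‖T z n‖ + ‖u‖ := by
      rw [smul_apply, c0Coord_apply, norm_smul, norm_inv, hζ, h1, norm_mul, norm_inv, hb,
        RCLike.norm_of_nonneg (by positivity)]
      simp
    rw [h2]
    refine hxn.trans_le ?_
    rw [hTx]
    refine (norm_add_le _ _).trans (add_le_add le_rfl ?_)
    rw [norm_mul]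
    exact mul_le_of_le_one_left (norm_nonneg _) ((norm_c0_apply_le x n).trans hx)

end NullSequences

/-! ### The space ℓ¹: rearrangement invariance, separability, numerical index. -/

section SummableSequences

variable {𝕜 : Type*} [RCLike 𝕜]

theorem sum_norm_l1_le (f : lp (fun _ : ℕ => 𝕜) 1) (s : Finset ℕ) : ∑ i ∈ s, ‖f i‖ ≤ ‖f‖ := by
  rw [norm_l1_eq]
  exact (summable_norm_l1 f).sum_le_tsum s fun _ _ => norm_nonneg _

theorem mem_range_l1Seq {f : ℕ → 𝕜} :
    f ∈ LinearMap.range (l1Seq 𝕜) ↔ Summable fun n => ‖f n‖ := by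
  refine ⟨by rintro ⟨g, rfl⟩; exact summable_norm_l1 g, fun h => ?_⟩
  obtain ⟨g, hg, -⟩ := exists_l1Seq_eq (C := ∑' n, ‖f n‖) fun n =>
    h.sum_le_tsum _ fun _ _ => norm_nonneg _
  exact ⟨g, hg⟩

theorem isKotheSeqSpace_l1Seq : IsKotheSeqSpace (l1Seq 𝕜) where
  injective := l1Seq_injective
  solid f g hfg := exists_l1Seq_eq fun n =>
    (Finset.sum_le_sum fun i _ => hfg i).trans (sum_norm_l1_le g (Finset.range n))
  indicator_mem A hA := mem_range_l1Seq.2 <|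
    summable_of_hasFiniteSupport <| hA.subset fun n hn => by
      by_contra hc
      simp [hc] at hn

theorem unitVec_l1Seq (n : ℕ) : unitVec (l1Seq 𝕜) n = lp.single 1 n (1 : 𝕜) :=
  l1Seq_injective (by
    rw [isKotheSeqSpace_l1Seq.apply_unitVec]
    exact (lp.coeFn_single (E := fun _ : ℕ => 𝕜) 1 n 1).symm)

theorem norm_unitVec_l1Seq (n : ℕ) : ‖unitVec (l1Seq 𝕜) n‖ = 1 := by
  rw [unitVec_l1Seq, lp.norm_single (by norm_num), norm_one]

theorem hasSum_smul_unitVec_l1 (x : lp (fun _ : ℕ => 𝕜) 1) :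
    HasSum (fun i => l1Seq 𝕜 x i • unitVec (l1Seq 𝕜) i) x := by
  convert lp.hasSum_single (by simp) x using 2 with i
  rw [unitVec_l1Seq, ← lp.single_smul, l1Seq_apply, smul_eq_mul, mul_one]

variable (𝕜) in
theorem separableSpace_l1 : TopologicalSpace.SeparableSpace (lp (fun _ : ℕ => 𝕜) 1) :=
  separableSpace_of_tendsto_sum (J := l1Seq 𝕜) fun x => (hasSum_smul_unitVec_l1 x).tendsto_sum_nat

/-- The functionals on `ℓ¹` given by sequences bounded by one. -/
theorem exists_l1_dual {c : ℕ → 𝕜} (hc : ∀ n, ‖c n‖ ≤ 1) :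
    ∃ φ : StrongDual 𝕜 (lp (fun _ : ℕ => 𝕜) 1), ‖φ‖ ≤ 1 ∧
      ∀ x, HasSum (fun n => l1Seq 𝕜 x n * c n) (φ x) := by
  have hle : ∀ (x : lp (fun _ : ℕ => 𝕜) 1) n, ‖l1Seq 𝕜 x n * c n‖ ≤ ‖x n‖ := fun x n => by
    rw [norm_mul]
    exact mul_le_of_le_one_right (norm_nonneg _) (hc n)
  have hs : ∀ x : lp (fun _ : ℕ => 𝕜) 1, Summable fun n => l1Seq 𝕜 x n * c n := fun x =>
    Summable.of_norm_bounded (summable_norm_l1 x) (hle x)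
  let φ : lp (fun _ : ℕ => 𝕜) 1 →ₗ[𝕜] 𝕜 :=
    { toFun := fun x => ∑' n, l1Seq 𝕜 x n * c n
      map_add' := fun x y => by
        rw [← (hs x).tsum_add (hs y)]
        simp [add_mul]
      map_smul' := fun a x => by
        simp [mul_assoc, tsum_mul_left] }
  refine ⟨φ.mkContinuous 1 fun x => ?_, LinearMap.mkContinuous_norm_le _ zero_le_one _,
    fun x => (hs x).hasSum⟩
  rw [one_mul, norm_l1_eq]
  exact tsum_of_norm_bounded (summable_norm_l1 x).hasSum (hle x)

/-- For every summable sequence there are phases whose functional attains the norm there. -/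
theorem exists_l1_dual_eq_norm (t : lp (fun _ : ℕ => 𝕜) 1) :
    ∃ (c : ℕ → 𝕜) (φ : StrongDual 𝕜 (lp (fun _ : ℕ => 𝕜) 1)), (∀ n, ‖c n‖ = 1) ∧ ‖φ‖ ≤ 1 ∧
      (∀ x, HasSum (fun n => l1Seq 𝕜 x n * c n) (φ x)) ∧ φ t = (‖t‖ : 𝕜) := by
  choose c hc hc' using fun n => exists_phase (t n)
  obtain ⟨φ, hφ, hφs⟩ := exists_l1_dual fun n => (hc n).le
  refine ⟨c, φ, hc, hφ, hφs, (hφs t).unique ?_⟩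
  have h1 : HasSum (fun n => ‖t n‖) ‖t‖ := by
    rw [norm_l1_eq]
    exact (summable_norm_l1 t).hasSum
  convert (RCLike.hasSum_ofReal 𝕜).2 h1 using 2 with n
  rw [hc', mul_comm]
  rfl

theorem exists_kotheDual_l1 {c : ℕ → 𝕜} (hc : ∀ n, ‖c n‖ ≤ 1) :
    ∃ Φ, kotheDualSeq (l1Seq 𝕜) Φ = c := by
  obtain ⟨φ, -, hφ⟩ := exists_l1_dual hc
  obtain ⟨Φ, hΦ⟩ := exists_toDual_eq hφ
  refine ⟨Φ, ?_⟩
  ext n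
  change KotheDual.toDual _ Φ (unitVec (l1Seq 𝕜) n) = _
  rw [hΦ]
  refine (hφ _).unique ?_
  rw [isKotheSeqSpace_l1Seq.apply_unitVec]
  simpa [mul_comm] using hasSum_mul_single c n

/-- Every sequence of phases lies in the Köthe dual; pairing ψ with its own phases shows that it is
absolutely summable. -/
theorem inKotheBidual_l1_eq_top : inKotheBidual (l1Seq 𝕜) = ⊤ := by
  refine eq_top_iff.2 fun ψ _ => mem_range_l1Seq.2 ?_
  choose c hc hc' using fun n => exists_phase (kotheBidualSeq (l1Seq 𝕜) ψ n)
  obtain ⟨Φ, hΦ⟩ := exists_kotheDual_l1 fun n => (hc n).le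
  have h1 := (hasSum_kotheDualSeq (J := kotheDualSeq (l1Seq 𝕜)) (fun n => exists_kotheDual_l1 fun m =>
    by by_cases hm : m = n <;> simp [hm]) ψ Φ).summable
  rw [hΦ] at h1
  simp only [← hc'] at h1
  exact (RCLike.summable_ofReal 𝕜).1 h1

variable (𝕜) in
theorem isRISeqSpace_l1Seq : IsRISeqSpace (l1Seq 𝕜) where
  toIsKotheSeqSpace := isKotheSeqSpace_l1Seq
  perm_mem_iff τ f := by
    rw [mem_range_l1Seq, mem_range_l1Seq]
    exact (τ.symm.summable_iff (f := fun n => ‖f n‖)).symm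
  norm_perm τ x y h := by
    rw [norm_l1_eq, norm_l1_eq, ← τ.symm.tsum_eq fun n => ‖x n‖]
    exact tsum_congr fun n => congrArg norm (congrFun h n)
  norming x := by
    obtain ⟨c, φ, -, hφ, hs, hx⟩ := exists_l1_dual_eq_norm x
    refine IsGreatest.isLUB ⟨⟨φ, ⟨c, hs⟩, hφ, by simp [hx]⟩, ?_⟩
    rintro _ ⟨φ, -, hφ, rfl⟩
    simpa using φ.le_of_opNorm_le hφ x
  maximal_or_minimal := Or.inl inKotheBidual_l1_eq_top
  l1_subset f := ⟨f, rfl, le_rfl⟩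
  subset_linfty f n := lp.norm_apply_le_norm (by simp) f n

theorem norm_le_of_norm_unitVec_le {Y : Type*} [NormedAddCommGroup Y] [NormedSpace 𝕜 Y]
    (T : lp (fun _ : ℕ => 𝕜) 1 →L[𝕜] Y) {C : ℝ} (hC : 0 ≤ C)
    (h : ∀ n, ‖T (unitVec (l1Seq 𝕜) n)‖ ≤ C) : ‖T‖ ≤ C := by
  refine T.opNorm_le_bound hC fun x => ?_
  have hs := T.hasSum (hasSum_smul_unitVec_l1 x)
  refine le_of_tendsto (Filter.Tendsto.norm hs) (Filter.Eventually.of_forall fun s => ?_)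
  calc _ ≤ ∑ i ∈ s, ‖x i‖ * C := by
        refine (norm_sum_le _ _).trans (Finset.sum_le_sum fun i _ => ?_)
        rw [map_smul, norm_smul]
        exact mul_le_mul_of_nonneg_left (h i) (norm_nonneg _)
    _ ≤ C * ‖x‖ := by
        rw [← Finset.sum_mul, mul_comm]
        exact mul_le_mul_of_nonneg_left (sum_norm_l1_le x s) hC

variable (𝕜) in
-- ‖T‖ is the supremum of ‖T(e_n)‖. A functional norming T(e_n) can be chosen with unimodular
-- coefficients, and a rotation makes it equal 1 at e_n.
theorem hasNumericalIndexOne_l1 : HasNumericalIndexOne 𝕜 (lp (fun _ : ℕ => 𝕜) 1) := by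
  have := (isRISeqSpace_l1Seq 𝕜).nontrivial
  rw [hasNumericalIndexOne_iff]
  intro T r hr
  obtain ⟨n, hn⟩ : ∃ n, r < ‖T (unitVec (l1Seq 𝕜) n)‖ := by
    rcases lt_or_ge r 0 with h0 | h0
    · exact ⟨0, h0.trans_le (norm_nonneg _)⟩
    by_contra! hc
    exact absurd (norm_le_of_norm_unitVec_le T h0 hc) (not_le.2 hr)
  obtain ⟨c, φ, hc, hφ, hs, hT⟩ := exists_l1_dual_eq_norm (T (unitVec (l1Seq 𝕜) n))
  have hc0 : c n ≠ 0 := fun h => by simpa [h] using hc n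
  have hφn : φ (unitVec (l1Seq 𝕜) n) = c n := by
    refine (hs _).unique ?_
    rw [isKotheSeqSpace_l1Seq.apply_unitVec]
    simpa [mul_comm] using hasSum_mul_single c n
  refine ⟨unitVec (l1Seq 𝕜) n, (c n)⁻¹ • φ, norm_unitVec_l1Seq n, le_antisymm ?_ ?_, ?_, ?_⟩
  · rwa [norm_smul, norm_inv, hc, inv_one, one_mul]
  · have := ((c n)⁻¹ • φ).le_opNorm_of_le (norm_unitVec_l1Seq (𝕜 := 𝕜) n).le
    simpa [hφn, hc0] using this
  · simp [hφn, hc0]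
  · simpa [hT, hc] using hn

end SummableSequences

/-! ### The classification assembled. -/

section Main

variable {𝕜 : Type*} [RCLike 𝕜] {X : Type*} [NormedAddCommGroup X] [NormedSpace 𝕜 X]
  {J : X →ₗ[𝕜] (ℕ → 𝕜)}

theorem IsRISeqSpace.hasNumericalIndexOne_of_sameSeqSpace (h : IsRISeqSpace J)
    (hX : SameSeqSpace J (c0Seq 𝕜) ∨ SameSeqSpace J (l1Seq 𝕜)) : HasNumericalIndexOne 𝕜 X := by
  have := h.nontrivial
  rcases hX with ⟨e, -⟩ | ⟨e, -⟩
  · exact (hasNumericalIndexOne_c0 𝕜).of_linearIsometryEquiv e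
  · exact (hasNumericalIndexOne_l1 𝕜).of_linearIsometryEquiv e

end Main

end

theorem mainTheorem4 (𝕜 : Type*) [RCLike 𝕜] :
    (∀ (X : Type*) [NormedAddCommGroup X] [NormedSpace 𝕜 X] [CompleteSpace X]
        [TopologicalSpace.SeparableSpace X] (J : X →ₗ[𝕜] (ℕ → 𝕜)), IsRISeqSpace J →
        (HasNumericalIndexOne 𝕜 X ↔ SameSeqSpace J (c0Seq 𝕜) ∨ SameSeqSpace J (l1Seq 𝕜)) ∧
        (HasAlternativeDaugavet 𝕜 X ↔ SameSeqSpace J (c0Seq 𝕜) ∨ SameSeqSpace J (l1Seq 𝕜))) ∧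
    (CompleteSpace C₀(ℕ, 𝕜) ∧ TopologicalSpace.SeparableSpace C₀(ℕ, 𝕜) ∧
      IsRISeqSpace (c0Seq 𝕜) ∧
      HasNumericalIndexOne 𝕜 C₀(ℕ, 𝕜) ∧ HasAlternativeDaugavet 𝕜 C₀(ℕ, 𝕜)) ∧
    (CompleteSpace (lp (fun _ : ℕ => 𝕜) 1) ∧
      TopologicalSpace.SeparableSpace (lp (fun _ : ℕ => 𝕜) 1) ∧
      IsRISeqSpace (l1Seq 𝕜) ∧
      HasNumericalIndexOne 𝕜 (lp (fun _ : ℕ => 𝕜) 1) ∧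
      HasAlternativeDaugavet 𝕜 (lp (fun _ : ℕ => 𝕜) 1)) := by
  refine ⟨fun X _ _ _ _ J h => ?_,
    ⟨inferInstance, separableSpace_c0 𝕜, isRISeqSpace_c0Seq 𝕜, hasNumericalIndexOne_c0 𝕜, ?_⟩,
    ⟨inferInstance, separableSpace_l1 𝕜, isRISeqSpace_l1Seq 𝕜, hasNumericalIndexOne_l1 𝕜, ?_⟩⟩
  · have := h.nontrivial
    exact ⟨⟨fun hX => h.sameSeqSpace_of_hasAlternativeDaugavet hX.hasAlternativeDaugavet,
      h.hasNumericalIndexOne_of_sameSeqSpace⟩,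
      ⟨h.sameSeqSpace_of_hasAlternativeDaugavet,
      fun hX => (h.hasNumericalIndexOne_of_sameSeqSpace hX).hasAlternativeDaugavet⟩⟩
  · have := (isRISeqSpace_c0Seq 𝕜).nontrivial
    exact (hasNumericalIndexOne_c0 𝕜).hasAlternativeDaugavet
  · have := (isRISeqSpace_l1Seq 𝕜).nontrivial
    exact (hasNumericalIndexOne_l1 𝕜).hasAlternativeDaugavet
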